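/- Let $D$ be a diagram of an unoriented link $L$, with crossings $c_1,\dots,c_n$. A state is a function $s:\{c_1,\dots,c_n\}\to\{1,-1\}$; let $|sD|$ be the number of closed curves obtained by smoothing each crossing $c_i$ of $D$, by the $A$-smoothing if $s(c_i)=1$ and by the $B$-smoothing if $s(c_i)=-1$. Let $s_A\equiv 1$ and $s_B\equiv -1$. The diagram $D$ is *adequate* if $|s_AD|>|sD|$ for every state $s$ with $\sum_i s(c_i)=n-2$ and $|s_BD|>|sD|$ for every state $s$ with $\sum_i s(c_i)=2-n$. A link is *adequate* if it has an adequate diagram. A crossing drawn in a disc with the four boundary points NE, NW, SW, SE has sign $1$ if its over-strand joins SW with NE, and sign $-1$ if its over-strand joins SE with NW. For nonzero integers $a_1,\dots,a_n$, $n\ge 1$, all of the same sign $\varepsilon$, the standard diagram of a rational tangle with continued fraction $[a_1,\dots,a_n]$ is built from $|a_1|$ twists in a horizontal row or in a vertical stack by adding, for $i=2,\dots,n$, $|a_i|$ twists, alternately vertically at the bottom and horizontally on the right, so that two successive boxes of twists have different directions; all its crossings, as seen in the disc of the tangle, have the sign $\varepsilon$. (Drawn as a horizontal braid on three strands, the vertical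 boxes are turned by a right angle, and their crossings get the opposite sign.) Both choices of the direction of the first box are allowed. The sum of two tangles places them side by side, the product places one on top of the other, with the adjacent end points joined. A *block* of rational tangles is a tangle diagram built from such rational tangles by finitely many sums and products. It *extends* a crossing $c$ if, for each of its rational tangles, all denominators $a_i$ have the sign of $c$. **Theorem.** Let $D$ be an adequate diagram of a link $L$, let $c$ be any crossing of $D$, drawn in a small disc in any of the four possible positions, and let $b$ be a block of rational tangles that extends $c$, the sign of $c$ being taken in this position. Let $D^*$ be obtained from $D$ by replacing $c$ by $b$ inside this disc. Then $D^*$ is an adequate link diagram, and hence the link $L^*$ with diagram $D^*$ is adequate. -/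

import Mathlib

namespace PlanarLink

/-! Planar diagrams of unoriented links, encoded by crossings, arcs and incidences. -/

/-- Raw planar diagram data. Each crossing `c` has four ends `0, 1, 2, 3`, listed counterclockwise,
so that the strand through the ends `0, 2` passes under the strand through the ends `1, 3`;
`ends c i` is the arc that arrives at the end `i` of `c`. An arc which arrives at no crossing stands
for a closed circle without crossings. -/
structure PDCode : Type 1 where
  Crossing : Type
  Arc : Type
  [finite_crossing : Finite Crossing]
  [finite_arc : Finite Arc]
  ends : Crossing → Fin 4 → Arc

attribute [instance] PDCode.finite_crossing PDCode.finite_arc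

/-- A tangle diagram in a disc, with boundary points indexed by `ι`: as above, and `boundary i` is
the arc that arrives at the boundary point `i`. -/
structure PDTangle (ι : Type) : Type 1 extends PDCode where
  boundary : ι → Arc

namespace PDCode

/-- An isomorphism of diagram data: it matches crossings and arcs, and at each crossing it matches
the ends by a rotation that keeps over-strands over (a rotation by `0` or by `2`). -/
structure Iso (D E : PDCode) where
  crossing : D.Crossing ≃ E.Crossing
  arc : D.Arc ≃ E.Arc
  rot : D.Crossing → Fin 4
  rot_eq : ∀ c, rot c = 0 ∨ rot c = 2
  ends_eq : ∀ c i, E.ends (crossing c) (i + rot c) = arc (D.ends c i)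

/-- Two crossings are adjacent if some arc arrives at both of them. -/
def Adj (D : PDCode) (c d : D.Crossing) : Prop :=
  ∃ i j, D.ends c i = D.ends d j

/-- The connected components of the underlying four-valent graph
(circles without crossings are not counted). -/
def Component (D : PDCode) : Type := Quot D.Adj

/-- The corner `(c, i)` is the angle at `c` between the ends `i` and `i + 1`. An arc that leaves `c`
by its end `i` and arrives at the end `j` of `d` has the corner `(c, i)` at its start and the corner
`(d, j - 1)` at its end, both on its left: they lie in the same face. -/
def SameFace (D : PDCode) (x y : D.Crossing × Fin 4) : Prop :=
  ∃ j : Fin 4, D.ends x.1 x.2 = D.ends y.1 j ∧ x ≠ (y.1, j) ∧ y.2 = j - 1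

/-- The faces of the underlying four-valent graph, as classes of corners, each connected component
being drawn on a sphere of its own. -/
def Face (D : PDCode) : Type := Quot D.SameFace

/-- `D` is a link diagram: each arc has two ends at crossings, or none if it is a circle without
crossings, and the cellular surface given by the cyclic orders at the crossings is a union of
spheres. The latter is Euler's formula `V - E + F = 2 K`, where `E = 2 V` since each vertex has
valency four. -/
def IsLinkDiagram (D : PDCode) : Prop :=
  (∀ a : D.Arc, Nat.card {x : D.Crossing × Fin 4 // D.ends x.1 x.2 = a} = 0 ∨
    Nat.card {x : D.Crossing × Fin 4 // D.ends x.1 x.2 = a} = 2) ∧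
  Nat.card D.Face = Nat.card D.Crossing + 2 * Nat.card D.Component

/-- A state: `1` stands for the A-smoothing, `-1` for the B-smoothing. -/
abbrev State (D : PDCode) : Type := D.Crossing → ℤˣ

/-- The connections made by smoothing. Turning the over-strand (ends `1, 3`) counterclockwise sweeps
the corners between the ends `1, 2` and between the ends `3, 0`; the A-smoothing merges these two
regions, so it connects end `0` with end `1` and end `2` with end `3`. The B-smoothing connects
end `1` with end `2` and end `3` with end `0`. -/
inductive Smooth (D : PDCode) (s : D.State) : D.Arc → D.Arc → Prop
  | a01 (c : D.Crossing) (h : s c = 1) : Smooth D s (D.ends c 0) (D.ends c 1)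
  | a23 (c : D.Crossing) (h : s c = 1) : Smooth D s (D.ends c 2) (D.ends c 3)
  | b12 (c : D.Crossing) (h : s c = -1) : Smooth D s (D.ends c 1) (D.ends c 2)
  | b30 (c : D.Crossing) (h : s c = -1) : Smooth D s (D.ends c 3) (D.ends c 0)

/-- The number `|sD|` of closed curves of the state diagram `sD`. -/
noncomputable def circles (D : PDCode) (s : D.State) : ℕ := Nat.card (Quot (D.Smooth s))

/-- The sum of the values of a state. -/
noncomputable def stateSum (D : PDCode) (s : D.State) : ℤ := ∑ᶠ c, (s c : ℤ)

/-- `|s_A D| > |sD|` for each state `s` with sum `n - 2`. -/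
def AAdequate (D : PDCode) : Prop :=
  ∀ s : D.State, D.stateSum s = (Nat.card D.Crossing : ℤ) - 2 →
    D.circles s < D.circles (fun _ => 1)

/-- `|s_B D| > |sD|` for each state `s` with sum `2 - n`. -/
def BAdequate (D : PDCode) : Prop :=
  ∀ s : D.State, D.stateSum s = 2 - (Nat.card D.Crossing : ℤ) →
    D.circles s < D.circles (fun _ => -1)

def Adequate (D : PDCode) : Prop := D.AAdequate ∧ D.BAdequate

end PDCode

/-! Gluing of tangles. Gluing identifies arcs; arcs may thereby close up to circles. -/

namespace PDTangle

/-- The identifications of arcs when each boundary point of `O` is glued to the boundary point of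
`T` with the same index. -/
inductive GlueRel {ι : Type} (O T : PDTangle ι) : O.Arc ⊕ T.Arc → O.Arc ⊕ T.Arc → Prop
  | glue (i : ι) : GlueRel O T (Sum.inl (O.boundary i)) (Sum.inr (T.boundary i))

/-- The closed diagram made of `T` inside a disc and `O` outside of it. -/
def glue {ι : Type} (O T : PDTangle ι) : PDCode where
  Crossing := O.Crossing ⊕ T.Crossing
  Arc := Quot (GlueRel O T)
  finite_arc := Quot.finite _
  ends := Sum.elim (fun c i => Quot.mk _ (Sum.inl (O.ends c i)))
    (fun c i => Quot.mk _ (Sum.inr (T.ends c i)))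

end PDTangle

/-- A tangle diagram with the four boundary points, counterclockwise,
`0 = NE`, `1 = NW`, `2 = SW`, `3 = SE`. -/
abbrev Tangle : Type 1 := PDTangle (Fin 4)

namespace Tangle

/-- The tangle without crossings whose arcs join NE with NW and SW with SE. -/
def zero : Tangle where
  Crossing := Empty
  Arc := Fin 2
  ends := fun c _ => c.elim
  boundary := ![0, 0, 1, 1]

/-- The tangle without crossings whose arcs join NW with SW and NE with SE. -/
def infinity : Tangle where
  Crossing := Empty
  Arc := Fin 2
  ends := fun c _ => c.elim
  boundary := ![0, 1, 1, 0]

/-- A single crossing of sign `1` (the over-strand runs from SW to NE, and the A-smoothing joins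
NW with SW and NE with SE) or of sign `-1` (the over-strand runs from SE to NW). -/
def crossing (e : ℤˣ) : Tangle where
  Crossing := Unit
  Arc := Fin 4
  ends := fun _ i => i
  boundary := fun j => if e = 1 then j + 1 else j

/-- The identifications of arcs in `T + U`: NE of `T` with NW of `U`, SE of `T` with SW of `U`. -/
inductive SumRel (T U : Tangle) : T.Arc ⊕ U.Arc → T.Arc ⊕ U.Arc → Prop
  | north : SumRel T U (Sum.inl (T.boundary 0)) (Sum.inr (U.boundary 1))
  | south : SumRel T U (Sum.inl (T.boundary 3)) (Sum.inr (U.boundary 2))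

/-- The sum of tangles: `T` to the left of `U`. -/
def sum (T U : Tangle) : Tangle where
  Crossing := T.Crossing ⊕ U.Crossing
  Arc := Quot (SumRel T U)
  finite_arc := Quot.finite _
  ends := Sum.elim (fun c i => Quot.mk _ (Sum.inl (T.ends c i)))
    (fun c i => Quot.mk _ (Sum.inr (U.ends c i)))
  boundary := ![Quot.mk _ (Sum.inr (U.boundary 0)), Quot.mk _ (Sum.inl (T.boundary 1)),
    Quot.mk _ (Sum.inl (T.boundary 2)), Quot.mk _ (Sum.inr (U.boundary 3))]

/-- The identifications of arcs in `T * U`: SW of `T` with NW of `U`, SE of `T` with NE of `U`. -/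
inductive ProdRel (T U : Tangle) : T.Arc ⊕ U.Arc → T.Arc ⊕ U.Arc → Prop
  | west : ProdRel T U (Sum.inl (T.boundary 2)) (Sum.inr (U.boundary 1))
  | east : ProdRel T U (Sum.inl (T.boundary 3)) (Sum.inr (U.boundary 0))

/-- The product of tangles: `T` on top of `U`. -/
def prod (T U : Tangle) : Tangle where
  Crossing := T.Crossing ⊕ U.Crossing
  Arc := Quot (ProdRel T U)
  finite_arc := Quot.finite _
  ends := Sum.elim (fun c i => Quot.mk _ (Sum.inl (T.ends c i)))
    (fun c i => Quot.mk _ (Sum.inr (U.ends c i)))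
  boundary := ![Quot.mk _ (Sum.inl (T.boundary 0)), Quot.mk _ (Sum.inl (T.boundary 1)),
    Quot.mk _ (Sum.inr (U.boundary 2)), Quot.mk _ (Sum.inr (U.boundary 3))]

/-- A horizontal row of `n` crossings of sign `e`. -/
def row (e : ℤˣ) : ℕ → Tangle
  | 0 => zero
  | n + 1 => (row e n).sum (crossing e)

/-- A vertical stack of `n` crossings of sign `e`. -/
def stack (e : ℤˣ) : ℕ → Tangle
  | 0 => infinity
  | n + 1 => (stack e n).prod (crossing e)

/-- The sign of a crossing in a box with denominator `a` (irrelevant for `a = 0`). -/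
def boxSign (a : ℤ) : ℤˣ := if 0 ≤ a then 1 else -1

/-- The direction of the twists in a box. -/
inductive Axis
  | horizontal
  | vertical

/-- Add to `T` boxes of twists with denominators `a₁, a₂, …`, alternately as horizontal twists on
the right and as vertical twists at the bottom, the first of them along the given axis. -/
def addBoxes (T : Tangle) : Axis → List ℤ → Tangle
  | _, [] => T
  | .horizontal, a :: l => addBoxes (T.sum (row (boxSign a) a.natAbs)) .vertical l
  | .vertical, a :: l => addBoxes (T.prod (stack (boxSign a) a.natAbs)) .horizontal l

/-- The standard diagram of the rational tangle of the continued fraction `[a₁, …, aₙ]`, whose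
innermost box, with denominator `a₁`, lies along the given axis. In this diagram all crossings of
the `i`-th box have the sign of `aᵢ`. (If the end at NW is kept fixed and the other three strands
are drawn as a horizontal braid, then the vertical boxes are turned by a right angle, which changes
the sign of their crossings.) -/
def rational : Axis → List ℤ → Tangle
  | .horizontal, l => addBoxes zero .horizontal l
  | .vertical, l => addBoxes infinity .vertical l

end Tangle

/-- A block of rational tangles: an expression built from rational tangles by finitely many sums
and products. -/
inductive Block
  | rational (axis : Tangle.Axis) (a : List ℤ)
  | sum (b b' : Block)
  | prod (b b' : Block)

namespace Block

/-- The tangle diagram of a block. -/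
def tangle : Block → Tangle
  | rational axis a => Tangle.rational axis a
  | sum b b' => b.tangle.sum b'.tangle
  | prod b b' => b.tangle.prod b'.tangle

/-- A block extends a crossing of sign `e` if, for each of its rational tangles, all denominators
of the continued fraction have the sign `e`. -/
def Extends (e : ℤˣ) : Block → Prop
  | rational _ a => a ≠ [] ∧ ∀ x ∈ a, x.sign = (e : ℤ)
  | sum b b' => b.Extends e ∧ b'.Extends e
  | prod b b' => b.Extends e ∧ b'.Extends e

end Block

namespace PDCode

/-- The outside of a small disc around the crossing `c`. The disc is drawn in such a way that the
end `k` of `c` is at NE. -/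
def outside (D : PDCode) (c : D.Crossing) (k : Fin 4) : Tangle where
  Crossing := {d : D.Crossing // d ≠ c}
  Arc := D.Arc
  ends := fun d i => D.ends d.1 i
  boundary := fun j => D.ends c (j + k)

/-- The diagram obtained from `D` by replacing the crossing `c` by the tangle `T`, when the end `k`
of `c` is drawn at NE. -/
def replace (D : PDCode) (c : D.Crossing) (k : Fin 4) (T : Tangle) : PDCode :=
  (D.outside c k).glue T

/-- The sign of a crossing, when its end `k` is drawn at NE: it is `1` if the strand that joins SW
with NE passes over. (By the convention on the ends this is determined by the parity of `k`.) -/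
def sign (D : PDCode) (_c : D.Crossing) (k : Fin 4) : ℤˣ := if k = 1 ∨ k = 3 then 1 else -1

end PDCode

/-! Links, as link diagrams up to Reidemeister moves. -/

namespace Reidemeister

/-- A single strand between two boundary points. -/
def strand : PDTangle (Fin 2) where
  Crossing := Empty
  Arc := Unit
  ends := fun c _ => c.elim
  boundary := fun _ => ()

/-- A strand with a kink whose loop joins the ends `i` and `i + 1` of its crossing. -/
def kink (i : Fin 4) : PDTangle (Fin 2) where
  Crossing := Unit
  Arc := Fin 3
  ends := fun _ j => (![0, 0, 1, 2] : Fin 4 → Fin 3) (j - i)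
  boundary := ![1, 2]

/-- Two strands that form a bigon. The boundary points are numbered counterclockwise; the strand
from `0` to `3` passes over or under the strand from `1` to `2` at both crossings, according to
the parity of `i`. -/
def bigon (i : Fin 4) : Tangle where
  Crossing := Fin 2
  Arc := Fin 6
  ends := fun c j => (![![0, 1, 2, 3], ![5, 1, 0, 4]] : Fin 2 → Fin 4 → Fin 6) c (j - i)
  boundary := ![2, 3, 4, 5]

/-- The ends of a crossing of strands `x` and `y`, whose incoming and outgoing arcs are, in
counterclockwise order, `x₀`, `y₀`, `x₁`, `y₁`; the strand `x` passes over if `o` is true,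
and under otherwise. -/
def cross {A : Type} (o : Bool) (x₀ y₀ x₁ y₁ : A) : Fin 4 → A :=
  if o then ![y₁, x₀, y₀, x₁] else ![x₀, y₀, x₁, y₁]

/-- Three strands that form a triangle. There are six boundary points `0, …, 5`, numbered
counterclockwise, and the strand `s = 0, 1, 2` runs from `s` to `s + 3` through its arcs `(s, 0)`,
`(s, 1)`, `(s, 2)`. The strand `0` passes over the other two, and the strand `1` passes over or
under the strand `2` according to `o`. The crossings `0`, `1`, `2` are those of the strands
`0, 1`, of `0, 2`, and of `1, 2`. Here strand `0` meets `1` and then `2`, strand `1` meets `0`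
and then `2`, and strand `2` meets `0` and then `1`. -/
def triangle (o : Bool) : PDTangle (Fin 6) where
  Crossing := Fin 3
  Arc := Fin 3 × Fin 3
  ends := ![cross true (0, 0) (1, 0) (0, 1) (1, 1),
    cross true (0, 1) (2, 0) (0, 2) (2, 1),
    cross o (1, 1) (2, 1) (1, 2) (2, 2)]
  boundary := ![(0, 0), (1, 0), (2, 0), (0, 2), (1, 2), (2, 2)]

/-- As `triangle`, but each strand meets the other two in the opposite order. -/
def triangle' (o : Bool) : PDTangle (Fin 6) where
  Crossing := Fin 3
  Arc := Fin 3 × Fin 3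
  ends := ![cross true (0, 1) (1, 1) (0, 2) (1, 2),
    cross true (0, 0) (2, 1) (0, 1) (2, 2),
    cross o (1, 0) (2, 0) (1, 1) (2, 1)]
  boundary := ![(0, 0), (1, 0), (2, 0), (0, 2), (1, 2), (2, 2)]

/-- `Local T T' D D'`: the diagram `D'` arises from `D` by replacing a copy of the tangle `T`
by the tangle `T'`. -/
def Local {ι : Type} (T T' : PDTangle ι) (D D' : PDCode) : Prop :=
  ∃ O : PDTangle ι, Nonempty (D.Iso (O.glue T)) ∧ Nonempty (D'.Iso (O.glue T'))

/-- One step between diagrams: an isomorphism or a Reidemeister move of type I, II or III. -/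
inductive Step (D D' : PDCode) : Prop
  | iso (h : Nonempty (D.Iso D'))
  | one (i : Fin 4) (h : Local (kink i) strand D D')
  | two (i : Fin 4) (h : Local (bigon i) Tangle.infinity D D')
  | three (o : Bool) (h : Local (triangle o) (triangle' o) D D')

end Reidemeister

/-- Link diagrams on the sphere; for diagrams that are not connected, the way in which the
components are placed in each other's faces is not recorded, as it does not affect the link. -/
def LinkDiagram : Type 1 := {D : PDCode // D.IsLinkDiagram}

/-- Links up to isotopy: link diagrams up to the equivalence relation generated by isomorphisms and
Reidemeister moves. -/
def Link : Type 1 := Quot fun D D' : LinkDiagram => Reidemeister.Step D.1 D'.1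

/-- The link of a diagram. -/
def LinkDiagram.link (D : LinkDiagram) : Link := Quot.mk _ D

/-- A link is adequate if it has an adequate diagram. -/
def Link.Adequate (L : Link) : Prop := ∃ D : LinkDiagram, D.link = L ∧ D.1.Adequate

end PlanarLink

/-! The heart is the doubling of one crossing. In the constant state `e`, adequacy says that
changing any single smoothing lowers the number of circles. Replace a crossing by two copies of it
side by side. One of its two smoothings looks like the tangle `zero`, the other like `infinity`;
`zero` is neutral for the sum, while the sum of two copies of `infinity` is `infinity` together with
a small circle. If the state `e` smooths like `zero`, then no circle count changes, and changing one
of the two copies amounts to changing the original crossing. If it smooths like `infinity`, then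
there is one more circle; changing another crossing keeps this circle, and changing one of the two
copies merely destroys it. In all cases the count drops (`adequateAt_closeTwo`). Planarity survives
because doubling adds one crossing, one bigon face and no component (`isLinkDiagram_closeTwo`).
Stacking two crossings is the same operation turned by a right angle.

The rest is formal. `PreservesAdequacy e T` quantifies over all outsides, so the rest of a diagram
may always be absorbed into the outside. To insert `T + U`, double the crossing, replace the left
copy by `T` with the right one counted as outside, then replace the right copy by `U` with `T`
counted as outside. Thus the class of such tangles contains the crossing and is closed under sums
and products, and induction covers rows, stacks, rational tangles and blocks. -/

namespace PlanarLink

/-! ### Comparing classes of arcs and corners; signs of ends. -/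

/-- Quotients are equivalent if there are maps between the underlying types that respect the
relations and are inverse to each other up to the relations. -/
def quotEquiv {α β : Type} {r : α → α → Prop} {s : β → β → Prop} (f : α → β) (g : β → α)
    (hf : ∀ x y, r x y → Quot.mk s (f x) = Quot.mk s (f y))
    (hg : ∀ x y, s x y → Quot.mk r (g x) = Quot.mk r (g y))
    (hgf : ∀ x, Quot.mk r (g (f x)) = Quot.mk r x)
    (hfg : ∀ y, Quot.mk s (f (g y)) = Quot.mk s y) : Quot r ≃ Quot s where
  toFun := Quot.lift (fun x => Quot.mk s (f x)) hf
  invFun := Quot.lift (fun y => Quot.mk r (g y)) hg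
  left_inv := by rintro ⟨x⟩; exact hgf x
  right_inv := by rintro ⟨y⟩; exact hfg y

/-- A quotient with one class, that of `o`, more than another one. -/
def quotEquivOption {α β : Type} {r : α → α → Prop} {s : β → β → Prop}
    (f : α → Option (Quot s)) (g : β → α) (o : α)
    (hf : ∀ x y, r x y → f x = f y)
    (hg : ∀ x y, s x y → Quot.mk r (g x) = Quot.mk r (g y))
    (hgf : ∀ x, (f x = none ∧ Quot.mk r x = Quot.mk r o) ∨
      ∃ y, f x = some (Quot.mk s y) ∧ Quot.mk r x = Quot.mk r (g y))
    (hfo : f o = none) (hfg : ∀ y, f (g y) = some (Quot.mk s y)) :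
    Quot r ≃ Option (Quot s) where
  toFun := Quot.lift f hf
  invFun := fun z => z.elim (Quot.mk r o) (Quot.lift (fun y => Quot.mk r (g y)) hg)
  left_inv := by
    rintro ⟨x⟩
    rcases hgf x with ⟨h, h'⟩ | ⟨y, h, h'⟩ <;> simp [h, h']
  right_inv := by
    rintro (_ | ⟨⟨y⟩⟩)
    · exact hfo
    · exact hfg y

/-- The value of a state for which the end `i` of a crossing is connected with the end `i + 1`. -/
def endSign (i : Fin 4) : ℤˣ := if i = 0 ∨ i = 2 then 1 else -1

theorem endSign_add (i j : Fin 4) : endSign (i + j) = endSign i * endSign j := by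
  revert i j; decide

theorem endSign_mul_self (i : Fin 4) : endSign i * endSign i = 1 := by
  revert i; decide

/-! ### Isomorphisms of diagrams and of their plane graphs. -/

namespace PDCode

theorem smooth_iff {D : PDCode} {s : D.State} {x y : D.Arc} :
    D.Smooth s x y ↔
      ∃ c i, s c = endSign i ∧ x = D.ends c i ∧ y = D.ends c (i + 1) := by
  constructor
  · rintro (⟨c, h⟩ | ⟨c, h⟩ | ⟨c, h⟩ | ⟨c, h⟩)
    · exact ⟨c, 0, h, rfl, rfl⟩
    · exact ⟨c, 2, h, rfl, rfl⟩
    · exact ⟨c, 1, h, rfl, rfl⟩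
    · exact ⟨c, 3, h, rfl, rfl⟩
  · rintro ⟨c, i, h, rfl, rfl⟩
    fin_cases i
    · exact .a01 c h
    · exact .b12 c h
    · exact .a23 c h
    · exact .b30 c h

theorem mk_ends (D : PDCode) (s : D.State) (c : D.Crossing) (i : Fin 4) (h : s c = endSign i) :
    Quot.mk (D.Smooth s) (D.ends c i) = Quot.mk (D.Smooth s) (D.ends c (i + 1)) :=
  Quot.sound (smooth_iff.2 ⟨c, i, h, rfl, rfl⟩)

/-- An isomorphism of the underlying four-valent plane graphs. -/
structure ShadowIso (D E : PDCode) where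
  crossing : D.Crossing ≃ E.Crossing
  arc : D.Arc ≃ E.Arc
  rot : D.Crossing → Fin 4
  ends_eq : ∀ c i, E.ends (crossing c) (i + rot c) = arc (D.ends c i)

def Iso.shadow {D E : PDCode} (f : D.Iso E) : D.ShadowIso E where
  crossing := f.crossing
  arc := f.arc
  rot := f.rot
  ends_eq := f.ends_eq

namespace ShadowIso

variable {D E : PDCode} (f : D.ShadowIso E)

def symm : E.ShadowIso D where
  crossing := f.crossing.symm
  arc := f.arc.symm
  rot c := -f.rot (f.crossing.symm c)
  ends_eq c i := by
    rw [Equiv.eq_symm_apply, ← f.ends_eq, neg_add_cancel_right, Equiv.apply_symm_apply]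

/-- The bijection between the ends of crossings. It also matches the corners. -/
def ends : D.Crossing × Fin 4 ≃ E.Crossing × Fin 4 :=
  Equiv.prodShear f.crossing fun c => Equiv.addRight (f.rot c)

theorem ends_apply (x : D.Crossing × Fin 4) :
    f.ends x = (f.crossing x.1, x.2 + f.rot x.1) := rfl

theorem arc_ends (x : D.Crossing × Fin 4) :
    E.ends (f.ends x).1 (f.ends x).2 = f.arc (D.ends x.1 x.2) := f.ends_eq _ _

theorem sameFace_iff (x y : D.Crossing × Fin 4) :
    D.SameFace x y ↔ E.SameFace (f.ends x) (f.ends y) := by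
  have key : ∀ j : Fin 4, (y.1, j) = x ↔ (f.crossing y.1, j + f.rot y.1) = f.ends x := fun j =>
    (f.ends.apply_eq_iff_eq (x := (y.1, j)) (y := x)).symm
  constructor
  · rintro ⟨j, h, hne, hj⟩
    refine ⟨j + f.rot y.1, ?_, fun h' => hne ((key j).2 h'.symm).symm, ?_⟩
    · rw [f.arc_ends, h]; exact (f.ends_eq _ _).symm
    · rw [ends_apply, hj]; exact sub_add_eq_add_sub _ _ _
  · rintro ⟨j, h, hne, hj⟩
    obtain ⟨i, rfl⟩ : ∃ i, j = i + f.rot y.1 := ⟨j - f.rot y.1, (sub_add_cancel _ _).symm⟩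
    refine ⟨i, ?_, fun h' => hne ((key i).1 h'.symm).symm, ?_⟩
    · rw [f.arc_ends, ends_apply, f.ends_eq] at h
      exact f.arc.injective h
    · rw [ends_apply, add_sub_right_comm] at hj
      exact add_right_cancel hj

theorem adj_iff (c d : D.Crossing) : D.Adj c d ↔ E.Adj (f.crossing c) (f.crossing d) := by
  constructor
  · rintro ⟨i, j, h⟩
    exact ⟨i + f.rot c, j + f.rot d, by rw [f.ends_eq, f.ends_eq, h]⟩
  · rintro ⟨i, j, h⟩
    refine ⟨i - f.rot c, j - f.rot d, f.arc.injective ?_⟩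
    rw [← f.ends_eq, ← f.ends_eq, sub_add_cancel, sub_add_cancel, h]

theorem isLinkDiagram {D E : PDCode} (f : D.ShadowIso E) (h : D.IsLinkDiagram) : E.IsLinkDiagram := by
  refine ⟨fun a => ?_, ?_⟩
  · have e : {x : D.Crossing × Fin 4 // D.ends x.1 x.2 = f.arc.symm a} ≃
        {x : E.Crossing × Fin 4 // E.ends x.1 x.2 = a} :=
      f.ends.subtypeEquiv fun x => by rw [f.arc_ends, ← f.arc.eq_symm_apply]
    rw [← Nat.card_congr e]
    exact h.1 _
  · have eF : D.Face ≃ E.Face := Quot.congr f.ends f.sameFace_iff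
    have eK : D.Component ≃ E.Component := Quot.congr f.crossing f.adj_iff
    rw [← Nat.card_congr eF, ← Nat.card_congr eK, ← Nat.card_congr f.crossing]
    exact h.2

/-- An odd rotation of a crossing exchanges its A- and B-smoothing, an even one keeps them. The
factor `endSign (f.rot c)` compensates for this, so both states join corresponding arcs. -/
theorem circles_eq (s : D.State) (t : E.State)
    (h : ∀ c, t (f.crossing c) = s c * endSign (f.rot c)) : E.circles t = D.circles s := by
  refine (Nat.card_congr (Quot.congr f.arc fun x y => ?_)).symm
  rw [smooth_iff, smooth_iff]
  constructor
  · rintro ⟨c, i, hs, rfl, rfl⟩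
    refine ⟨f.crossing c, i + f.rot c, ?_, (f.ends_eq _ _).symm, ?_⟩
    · rw [h, hs, endSign_add]
    · rw [← f.ends_eq, add_right_comm]
  · rintro ⟨c, i, hs, hx, hy⟩
    obtain ⟨c, rfl⟩ := f.crossing.surjective c
    obtain ⟨i, rfl⟩ : ∃ j, i = j + f.rot c := ⟨i - f.rot c, (sub_add_cancel _ _).symm⟩
    rw [f.ends_eq] at hx
    rw [add_right_comm, f.ends_eq] at hy
    refine ⟨c, i, ?_, f.arc.injective hx, f.arc.injective hy⟩
    rw [h, endSign_add] at hs
    exact mul_right_cancel hs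

end ShadowIso

/-- An isomorphism that keeps the numbering of the ends. -/
def Iso.ofEnds {D E : PDCode} (crossing : D.Crossing ≃ E.Crossing) (arc : D.Arc ≃ E.Arc)
    (h : ∀ c i, E.ends (crossing c) i = arc (D.ends c i)) : D.Iso E where
  crossing := crossing
  arc := arc
  rot _ := 0
  rot_eq _ := .inl rfl
  ends_eq c i := by rw [add_zero, h]

def Iso.symm {D E : PDCode} (f : D.Iso E) : E.Iso D where
  __ := f.shadow.symm
  rot_eq c := by
    rcases f.rot_eq (f.crossing.symm c) with h | h
    · exact .inl (by simp [ShadowIso.symm, Iso.shadow, h])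
    · exact .inr (by simp only [ShadowIso.symm, Iso.shadow, h]; rfl)

/-! ### Adequacy as a condition on changes of a single smoothing. -/

open Classical in
/-- Each change of a single smoothing in the constant state `e` lowers the number of circles. -/
def AdequateAt (D : PDCode) (e : ℤˣ) : Prop :=
  ∀ c, D.circles (Function.update (fun _ => e) c (-e)) < D.circles fun _ => e

-- If `m` of the `n` values differ from `e`, then the sum is `e * (n - 2 * m)`; so the prescribed
-- sum means `m = 1`.
open Classical in
theorem stateSum_eq_iff {D : PDCode} (e : ℤˣ) (s : D.State) :
    D.stateSum s = e * ((Nat.card D.Crossing : ℤ) - 2) ↔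
      ∃ c, s = Function.update (fun _ => e) c (-e) := by
  have := Fintype.ofFinite D.Crossing
  have hsum : D.stateSum s = e * (Nat.card D.Crossing : ℤ) -
      2 * e * (Finset.univ.filter fun c => s c ≠ e).card := by
    have h1 : ∀ c, (s c : ℤ) = e - 2 * e * (if s c ≠ e then 1 else 0) := by
      intro c
      rcases Int.units_eq_one_or (s c) with h | h <;>
        rcases Int.units_eq_one_or e with h' | h' <;> simp [h, h']
    rw [stateSum, finsum_eq_sum_of_fintype, Finset.sum_congr rfl fun c _ => h1 c,
      Finset.sum_sub_distrib, ← Finset.mul_sum, Finset.sum_boole]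
    simp [mul_comm]
  have hcard : D.stateSum s = e * ((Nat.card D.Crossing : ℤ) - 2) ↔
      (Finset.univ.filter fun c => s c ≠ e).card = 1 := by
    rw [hsum]
    rcases Int.units_eq_one_or e with h' | h' <;> simp [h']; omega
  rw [hcard, Finset.card_eq_one]
  refine exists_congr fun c => ?_
  rw [Finset.ext_iff, funext_iff]
  refine forall_congr' fun d => ?_
  by_cases hd : d = c
  · subst hd
    simp [Int.units_ne_iff_eq_neg]
  · simp [hd]

theorem aAdequate_iff {D : PDCode} : D.AAdequate ↔ D.AdequateAt 1 := by
  have h := fun s => stateSum_eq_iff (D := D) 1 s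
  simp only [Units.val_one, one_mul] at h
  constructor
  · exact fun H c => H _ ((h _).2 ⟨c, rfl⟩)
  · intro H s hs
    obtain ⟨c, rfl⟩ := (h s).1 hs
    exact H c

theorem bAdequate_iff {D : PDCode} : D.BAdequate ↔ D.AdequateAt (-1) := by
  have h := fun s => stateSum_eq_iff (D := D) (-1) s
  simp only [Units.val_neg, Units.val_one, neg_mul, one_mul, neg_sub] at h
  constructor
  · exact fun H c => H _ ((h _).2 ⟨c, by simp⟩)
  · intro H s hs
    obtain ⟨c, rfl⟩ := (h s).1 hs
    simpa using H c

theorem adequate_iff {D : PDCode} : D.Adequate ↔ ∀ e, D.AdequateAt e := by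
  rw [Adequate, aAdequate_iff, bAdequate_iff]
  refine ⟨fun h e => ?_, fun h => ⟨h 1, h (-1)⟩⟩
  rcases Int.units_eq_one_or e with rfl | rfl
  exacts [h.1, h.2]

/-- The diagram is an adequate link diagram. -/
def IsAdequateLinkDiagram (D : PDCode) : Prop := D.IsLinkDiagram ∧ D.Adequate

theorem Iso.isAdequateLinkDiagram {D E : PDCode} (f : D.Iso E) (h : D.IsAdequateLinkDiagram) :
    E.IsAdequateLinkDiagram := by
  classical
  refine ⟨f.shadow.isLinkDiagram h.1, adequate_iff.2 fun e c => ?_⟩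
  have hrot : ∀ c, endSign (f.rot c) = 1 := fun c => by
    rcases f.rot_eq c with h | h <;> rw [h] <;> rfl
  obtain ⟨c, rfl⟩ := f.crossing.surjective c
  rw [f.shadow.circles_eq (Function.update (fun _ => e) c (-e)) _ fun d => ?_,
    f.shadow.circles_eq (fun _ => e) (fun _ => e) fun d => by simp [Iso.shadow, hrot]]
  · exact adequate_iff.1 h.2 e c
  · by_cases hd : d = c <;> simp [Iso.shadow, hrot, hd]

end PDCode

/-! ### Doubling a crossing: planarity. -/

namespace Tangle

/-- The tangle `O` outside of a disc is closed by a crossing in the disc; the end `k` of this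
crossing is at NE. -/
abbrev close (O : Tangle) (k : Fin 4) : PDCode where
  Crossing := O.Crossing ⊕ Unit
  Arc := O.Arc
  ends := Sum.elim O.ends fun _ i => O.boundary (i - k)

/-- The tangle `O` outside of a disc is closed by two crossings side by side in the disc; the ends
`k` of these crossings are at NE. -/
abbrev closeTwo (O : Tangle) (k : Fin 4) : PDCode where
  Crossing := O.Crossing ⊕ Unit ⊕ Unit
  Arc := O.Arc ⊕ Bool
  ends := Sum.elim (fun c i => .inl (O.ends c i)) (Sum.elim
    (fun _ i => (![.inr false, .inl (O.boundary 1), .inl (O.boundary 2), .inr true] :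
      Fin 4 → O.Arc ⊕ Bool) (i - k))
    (fun _ i => (![.inl (O.boundary 0), .inr false, .inr true, .inl (O.boundary 3)] :
      Fin 4 → O.Arc ⊕ Bool) (i - k)))

/-- Turning the crossing inside the disc may exchange over and under, but the plane graph stays the
same. This reduces faces and circle counts to the case `k = 0`, in which the ends `0, 1, 2, 3` are
NE, NW, SW, SE. -/
def closeShadowIso (O : Tangle) (k : Fin 4) : (O.close 0).ShadowIso (O.close k) where
  crossing := Equiv.refl (O.Crossing ⊕ Unit)
  arc := Equiv.refl O.Arc
  rot := Sum.elim (fun _ => 0) fun _ => k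
  ends_eq := by
    rintro (c | c) i
    · simp [close]
    · simp [close]

def closeTwoShadowIso (O : Tangle) (k : Fin 4) : (O.closeTwo 0).ShadowIso (O.closeTwo k) where
  crossing := Equiv.refl (O.Crossing ⊕ Unit ⊕ Unit)
  arc := Equiv.refl (O.Arc ⊕ Bool)
  rot := Sum.elim (fun _ => 0) fun _ => k
  ends_eq := by rintro (c | c | c) i <;> simp [closeTwo]

variable (O : Tangle)

/-- The end of two crossings side by side that corresponds to an end of a single crossing. -/
def closeTwoEnd : (O.close 0).Crossing × Fin 4 → (O.closeTwo 0).Crossing × Fin 4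
  | (.inl d, i) => (.inl d, i)
  | (.inr _, i) => (.inr (if i = 0 ∨ i = 3 then .inr () else .inl ()), i)

theorem closeTwoEnd_snd (x : (O.close 0).Crossing × Fin 4) : (O.closeTwoEnd x).2 = x.2 := by
  rcases x with ⟨c | c, i⟩ <;> rfl

theorem closeTwoEnd_injective : Function.Injective O.closeTwoEnd := by
  rintro ⟨c | c, i⟩ ⟨d | d, j⟩ h
  · cases h; rfl
  · cases congrArg Prod.fst h
  · cases congrArg Prod.fst h
  · cases congrArg Prod.snd h; rfl

theorem ends_closeTwoEnd (x : (O.close 0).Crossing × Fin 4) :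
    (O.closeTwo 0).ends (O.closeTwoEnd x).1 (O.closeTwoEnd x).2 =
      .inl ((O.close 0).ends x.1 x.2) := by
  rcases x with ⟨c | c, i⟩
  · rfl
  · fin_cases i <;> simp [closeTwoEnd]

theorem exists_closeTwoEnd {x : (O.closeTwo 0).Crossing × Fin 4} {a : O.Arc}
    (h : (O.closeTwo 0).ends x.1 x.2 = .inl a) : ∃ y, O.closeTwoEnd y = x := by
  rcases x with ⟨c | c | c, i⟩
  · exact ⟨(.inl c, i), rfl⟩
  · fin_cases i <;> first | (cases h; done) | exact ⟨(.inr (), 1), rfl⟩ | exact ⟨(.inr (), 2), rfl⟩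
  · fin_cases i <;> first | (cases h; done) | exact ⟨(.inr (), 0), rfl⟩ | exact ⟨(.inr (), 3), rfl⟩

theorem card_closeTwo_ends_inl (a : O.Arc) :
    Nat.card {x : (O.closeTwo 0).Crossing × Fin 4 // (O.closeTwo 0).ends x.1 x.2 = .inl a} =
      Nat.card {x : (O.close 0).Crossing × Fin 4 // (O.close 0).ends x.1 x.2 = a} := by
  refine (Nat.card_congr (Equiv.ofBijective (fun x => ⟨O.closeTwoEnd x.1,
    by rw [ends_closeTwoEnd, x.2]⟩) ⟨?_, ?_⟩)).symm
  · intro x y h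
    exact Subtype.ext (O.closeTwoEnd_injective (congrArg Subtype.val h))
  · rintro ⟨x, h⟩
    obtain ⟨y, rfl⟩ := O.exists_closeTwoEnd h
    rw [ends_closeTwoEnd] at h
    exact ⟨⟨y, Sum.inl_injective h⟩, rfl⟩

theorem card_closeTwo_ends_inr (b : Bool) :
    Nat.card {x : (O.closeTwo 0).Crossing × Fin 4 // (O.closeTwo 0).ends x.1 x.2 = .inr b} =
      2 := by
  rw [Nat.card_eq_two_iff]
  cases b
  · refine ⟨⟨(.inr (.inl ()), 0), rfl⟩, ⟨(.inr (.inr ()), 1), rfl⟩, nofun,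
      Set.eq_univ_of_forall ?_⟩
    rintro ⟨⟨c | c | c, i⟩, h⟩
    · cases h
    all_goals fin_cases i <;> first | (cases h; done) | exact .inl rfl | exact .inr rfl
  · refine ⟨⟨(.inr (.inl ()), 3), rfl⟩, ⟨(.inr (.inr ()), 2), rfl⟩, nofun,
      Set.eq_univ_of_forall ?_⟩
    rintro ⟨⟨c | c | c, i⟩, h⟩
    · cases h
    all_goals fin_cases i <;> first | (cases h; done) | exact .inl rfl | exact .inr rfl

theorem close_face_eq {x : (O.close 0).Crossing × Fin 4} {c : (O.close 0).Crossing} {j : Fin 4}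
    (h : (O.close 0).ends x.1 x.2 = (O.close 0).ends c j) (hne : x ≠ (c, j)) :
    some (Quot.mk (O.close 0).SameFace x) = some (Quot.mk _ (c, j - 1)) :=
  congrArg some (Quot.sound ⟨j, h, hne, rfl⟩)

/-- This covers an arc of the outside that leaves the disc and returns to it without meeting a
crossing. -/
theorem close_face_boundary {i j : Fin 4} (h : O.boundary i = O.boundary j) (hne : i ≠ j) :
    some (Quot.mk (O.close 0).SameFace (.inr (), i)) = some (Quot.mk _ (.inr (), j - 1)) :=
  O.close_face_eq (by simpa [close] using h) fun e => hne (congrArg Prod.snd e)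

/-- A corner of two crossings side by side that corresponds to a corner of a single crossing. -/
def closeTwoCorner : (O.close 0).Crossing × Fin 4 → (O.closeTwo 0).Crossing × Fin 4
  | (.inl d, i) => (.inl d, i)
  | (.inr _, i) => (.inr (if i = 3 then .inr () else .inl ()), i)

/-- The northern one of the two arcs between the crossings has both northern corners on the same
side. -/
theorem mk_closeTwoCorner_zero :
    Quot.mk (O.closeTwo 0).SameFace (.inr (.inl ()), 0) = Quot.mk _ (.inr (.inr ()), 0) :=
  Quot.sound ⟨1, rfl, nofun, rfl⟩

theorem mk_closeTwoCorner_two :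
    Quot.mk (O.closeTwo 0).SameFace (.inr (.inl ()), 2) = Quot.mk _ (.inr (.inr ()), 2) :=
  (Quot.sound ⟨3, rfl, nofun, rfl⟩).symm

/-- A step along a face starts at the crossing that owns the end `i`. For the northern corner this
is the right crossing, whereas `closeTwoCorner` chose the left one; the choice is immaterial up to
`SameFace`. The next lemma does the same for the southern corner, at the end of a step. -/
theorem mk_closeTwoCorner (x : (O.close 0).Crossing × Fin 4) :
    Quot.mk (O.closeTwo 0).SameFace (O.closeTwoCorner x) = Quot.mk _ (O.closeTwoEnd x) := by
  rcases x with ⟨c | c, i⟩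
  · rfl
  · fin_cases i
    · exact O.mk_closeTwoCorner_zero
    all_goals rfl

theorem mk_closeTwoCorner_sub_one (c : (O.close 0).Crossing) (j : Fin 4) :
    Quot.mk (O.closeTwo 0).SameFace (O.closeTwoCorner (c, j - 1)) =
      Quot.mk _ ((O.closeTwoEnd (c, j)).1, j - 1) := by
  rcases c with c | c
  · rfl
  · fin_cases j
    · rfl
    · rfl
    · rfl
    · exact O.mk_closeTwoCorner_two

/-- Compared with a single crossing, two crossings side by side have the bigon between them as an
additional face. -/
def closeTwoFaceEquiv : (O.closeTwo 0).Face ≃ Option (O.close 0).Face :=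
  quotEquivOption
    (fun x => match x with
      | (.inl d, i) => some (Quot.mk _ (.inl d, i))
      | (.inr (.inl _), i) => if i = 3 then none else some (Quot.mk _ (.inr (), i))
      | (.inr (.inr _), i) => if i = 1 then none else some (Quot.mk _ (.inr (), i)))
    O.closeTwoCorner
    (.inr (.inl ()), 3)
    (by
      -- The arc may run between outside, left and right crossing. Steps along an inner arc are
      -- settled by `rfl`: their two corners are both northern, both southern, or both in the bigon,
      -- which is sent to `none`.
      rintro ⟨c | c | c, i⟩ ⟨d | d | d, _⟩ ⟨j, h, hne, rfl⟩
      · exact O.close_face_eq (Sum.inl_injective h) fun e => hne (by cases e; rfl)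
      · fin_cases j <;> simp [closeTwo] at h
        · exact O.close_face_eq (c := .inr ()) (j := 1) h nofun
        · exact O.close_face_eq (c := .inr ()) (j := 2) h nofun
      · fin_cases j <;> simp [closeTwo] at h
        · exact O.close_face_eq (c := .inr ()) (j := 0) h nofun
        · exact O.close_face_eq (c := .inr ()) (j := 3) h nofun
      · fin_cases i <;> simp [closeTwo] at h
        · exact O.close_face_eq (x := (.inr (), 1)) h nofun
        · exact O.close_face_eq (x := (.inr (), 2)) h nofun
      · fin_cases i <;> fin_cases j <;> simp [closeTwo] at h hne <;>
          have e := O.close_face_boundary h (by decide) <;> exact e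
      · fin_cases i <;> fin_cases j <;> simp [closeTwo] at h hne <;> first
          | rfl
          | have e := O.close_face_boundary h (by decide); exact e
      · fin_cases i <;> simp [closeTwo] at h
        · exact O.close_face_eq (x := (.inr (), 0)) h nofun
        · exact O.close_face_eq (x := (.inr (), 3)) h nofun
      · fin_cases i <;> fin_cases j <;> simp [closeTwo] at h hne <;> first
          | rfl
          | have e := O.close_face_boundary h (by decide); exact e
      · fin_cases i <;> fin_cases j <;> simp [closeTwo] at h hne <;>
          have e := O.close_face_boundary h (by decide) <;> exact e)
    (by
      rintro x ⟨c, _⟩ ⟨j, h, hne, rfl⟩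
      rw [mk_closeTwoCorner, mk_closeTwoCorner_sub_one]
      refine Quot.sound ⟨j, ?_, fun e => hne (O.closeTwoEnd_injective ?_), rfl⟩
      · rw [ends_closeTwoEnd, h]
        exact (O.ends_closeTwoEnd (c, j)).symm.trans (by rw [closeTwoEnd_snd])
      · exact e.trans (Prod.ext rfl (O.closeTwoEnd_snd (c, j)).symm))
    (by
      rintro ⟨c | c | c, i⟩
      · exact .inr ⟨(.inl c, i), rfl, rfl⟩
      · fin_cases i
        · exact .inr ⟨(.inr (), 0), rfl, rfl⟩
        · exact .inr ⟨(.inr (), 1), rfl, rfl⟩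
        · exact .inr ⟨(.inr (), 2), rfl, rfl⟩
        · exact .inl ⟨rfl, rfl⟩
      · fin_cases i
        · exact .inr ⟨(.inr (), 0), rfl, O.mk_closeTwoCorner_zero.symm⟩
        · exact .inl ⟨rfl, Quot.sound ⟨0, rfl, nofun, rfl⟩⟩
        · exact .inr ⟨(.inr (), 2), rfl, O.mk_closeTwoCorner_two.symm⟩
        · exact .inr ⟨(.inr (), 3), rfl, rfl⟩)
    rfl
    (by
      rintro ⟨c | c, i⟩
      · rfl
      · fin_cases i <;> rfl)

def closeTwoComponentEquiv : (O.closeTwo 0).Component ≃ (O.close 0).Component :=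
  quotEquiv (Sum.map id fun _ => ()) (Sum.map id .inl)
    (by
      rintro (c | c | c) (d | d | d) ⟨i, j, h⟩
      · exact Quot.sound ⟨i, j, Sum.inl_injective h⟩
      · fin_cases j <;> simp [closeTwo] at h
        · exact Quot.sound ⟨i, 1, h⟩
        · exact Quot.sound ⟨i, 2, h⟩
      · fin_cases j <;> simp [closeTwo] at h
        · exact Quot.sound ⟨i, 0, h⟩
        · exact Quot.sound ⟨i, 3, h⟩
      · fin_cases i <;> simp [closeTwo] at h
        · exact Quot.sound ⟨1, j, h⟩
        · exact Quot.sound ⟨2, j, h⟩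
      · rfl
      · rfl
      · fin_cases i <;> simp [closeTwo] at h
        · exact Quot.sound ⟨0, j, h⟩
        · exact Quot.sound ⟨3, j, h⟩
      · rfl
      · rfl)
    (by
      have key : ∀ x : (O.close 0).Crossing × Fin 4,
          Quot.mk (O.closeTwo 0).Adj (Sum.map id .inl x.1) =
            Quot.mk (O.closeTwo 0).Adj (O.closeTwoEnd x).1 := by
        rintro ⟨c | c, i⟩
        · rfl
        · by_cases h : i = 0 ∨ i = 3
          · simp only [closeTwoEnd, if_pos h]
            exact Quot.sound ⟨0, 1, rfl⟩
          · simp only [closeTwoEnd, if_neg h]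
            rfl
      rintro c d ⟨i, j, h⟩
      rw [key (c, i), key (d, j)]
      exact Quot.sound ⟨_, _, by rw [ends_closeTwoEnd, ends_closeTwoEnd, h]⟩)
    (by
      rintro (c | c | c)
      · rfl
      · rfl
      · exact Quot.sound ⟨0, 1, rfl⟩)
    (by rintro (c | c) <;> rfl)

/-- In Euler's formula the bigon on the side of the faces balances the additional crossing. The two
inner arcs have two ends each, and the other arcs keep theirs. -/
theorem isLinkDiagram_closeTwo {k : Fin 4} (h : (O.close k).IsLinkDiagram) :
    (O.closeTwo k).IsLinkDiagram := by
  refine (O.closeTwoShadowIso k).isLinkDiagram ?_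
  replace h := (O.closeShadowIso k).symm.isLinkDiagram h
  refine ⟨?_, ?_⟩
  · rintro (a | b)
    · rw [card_closeTwo_ends_inl]
      exact h.1 a
    · exact .inr (O.card_closeTwo_ends_inr b)
  · have hF := Nat.card_congr O.closeTwoFaceEquiv
    have : Finite (O.close 0).Face := Quot.finite _
    rw [Finite.card_option, h.2] at hF
    rw [hF, Nat.card_congr O.closeTwoComponentEquiv]
    simp only [Nat.card_sum, Nat.card_unique]
    omega

/-! ### Doubling a crossing: circle counts. -/

section Circles

variable {O} {t : (O.closeTwo 0).State} {s : (O.close 0).State}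

/-- The value `-1` gives vertical smoothings here. The two inner arcs then close up to a circle of
their own, and the outer sides join the boundary points as the single crossing does. -/
theorem circles_closeTwo_of_neg (hs : ∀ c, t (.inl c) = s (.inl c)) (h : s (.inr ()) = -1)
    (hl : t (.inr (.inl ())) = -1) (hr : t (.inr (.inr ())) = -1) :
    (O.closeTwo 0).circles t = (O.close 0).circles s + 1 := by
  have e : Quot ((O.closeTwo 0).Smooth t) ≃ Option (Quot ((O.close 0).Smooth s)) :=
    quotEquivOption
      (Sum.elim (fun a => some (Quot.mk _ a)) fun _ => none) .inl (.inr false)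
      (by
        intro x y hxy
        obtain ⟨c | c | c, i, hc, rfl, rfl⟩ := PDCode.smooth_iff.1 hxy
        · exact congrArg some ((O.close 0).mk_ends s (.inl c) i ((hs c).symm.trans hc))
        · replace hc := hl.symm.trans hc
          fin_cases i
          · exact absurd hc (by decide)
          · exact congrArg some ((O.close 0).mk_ends s (.inr ()) 1 h)
          · exact absurd hc (by decide)
          · rfl
        · replace hc := hr.symm.trans hc
          fin_cases i
          · exact absurd hc (by decide)
          · rfl
          · exact absurd hc (by decide)
          · exact congrArg some ((O.close 0).mk_ends s (.inr ()) 3 h))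
      (by
        intro x y hxy
        obtain ⟨c | c, i, hc, rfl, rfl⟩ := PDCode.smooth_iff.1 hxy
        · exact (O.closeTwo 0).mk_ends t (.inl c) i ((hs c).trans hc)
        · replace hc := h.symm.trans hc
          fin_cases i
          · exact absurd hc (by decide)
          · exact (O.closeTwo 0).mk_ends t (.inr (.inl ())) 1 hl
          · exact absurd hc (by decide)
          · exact (O.closeTwo 0).mk_ends t (.inr (.inr ())) 3 hr)
      (by
        rintro (a | _ | _)
        · exact .inr ⟨a, rfl, rfl⟩
        · exact .inl ⟨rfl, rfl⟩
        · exact .inl ⟨rfl, (O.closeTwo 0).mk_ends t (.inr (.inl ())) 3 hl⟩)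
      rfl fun _ => rfl
  have : Finite (Quot ((O.close 0).Smooth s)) := Quot.finite _
  exact (Nat.card_congr e).trans Finite.card_option

/-- No circle consists of inner arcs only if each inner arc `b` is connected with some arc `x b` of
the outside; sending `b` to `x b` then identifies the circles. -/
theorem circles_closeTwo_eq (hs : ∀ c, t (.inl c) = s (.inl c)) (x : Bool → O.Arc)
    (hf : ∀ c i, t (.inr c) = endSign i →
      Quot.mk ((O.close 0).Smooth s) (Sum.elim id x ((O.closeTwo 0).ends (.inr c) i)) =
        Quot.mk _ (Sum.elim id x ((O.closeTwo 0).ends (.inr c) (i + 1))))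
    (hg : ∀ i, s (.inr ()) = endSign i →
      Quot.mk ((O.closeTwo 0).Smooth t) (.inl (O.boundary i)) =
        Quot.mk _ (.inl (O.boundary (i + 1))))
    (hx : ∀ b, Quot.mk ((O.closeTwo 0).Smooth t) (.inl (x b)) = Quot.mk _ (.inr b)) :
    (O.closeTwo 0).circles t = (O.close 0).circles s := by
  refine Nat.card_congr (quotEquiv (Sum.elim id x) .inl ?_ ?_ ?_ fun _ => rfl)
  · intro x y hxy
    obtain ⟨c | c, i, hc, rfl, rfl⟩ := PDCode.smooth_iff.1 hxy
    · exact (O.close 0).mk_ends s (.inl c) i ((hs c).symm.trans hc)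
    · exact hf c i hc
  · intro x y hxy
    obtain ⟨c | c, i, hc, rfl, rfl⟩ := PDCode.smooth_iff.1 hxy
    · exact (O.closeTwo 0).mk_ends t (.inl c) i ((hs c).trans hc)
    · simpa using hg i hc
  · rintro (a | b)
    · rfl
    · exact hx b

/-- The value `1` smooths horizontally and is neutral for the sum, so the pair acts like the other
crossing. The product of the signs expresses this, except for two values `-1`, which `h'` rules out.
-/
theorem circles_closeTwo_of_one (hs : ∀ c, t (.inl c) = s (.inl c))
    (h : s (.inr ()) = t (.inr (.inl ())) * t (.inr (.inr ())))
    (h' : t (.inr (.inl ())) = 1 ∨ t (.inr (.inr ())) = 1) :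
    (O.closeTwo 0).circles t = (O.close 0).circles s := by
  have E := (O.close 0).mk_ends s (.inr ())
  have L := (O.closeTwo 0).mk_ends t (.inr (.inl ()))
  have R := (O.closeTwo 0).mk_ends t (.inr (.inr ()))
  rcases Int.units_eq_one_or (t (.inr (.inl ()))) with hl | hl <;>
    rcases Int.units_eq_one_or (t (.inr (.inr ()))) with hr | hr <;>
    simp only [hl, hr] at h h' E L R
  · have H0 : s (.inr ()) = endSign 0 := h
    have L0 := L 0 rfl
    have L2 := L 2 rfl
    -- The left crossing is smoothed horizontally, so it carries the inner arcs on to NW and SW.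
    refine circles_closeTwo_eq hs (fun b => O.boundary (if b then 2 else 1)) ?_ ?_ ?_
    · rintro (c | c) i hi
      · replace hi := hl.symm.trans hi
        fin_cases i <;> first | exact absurd hi (by decide) | rfl
      · replace hi := hr.symm.trans hi
        fin_cases i <;> first | exact absurd hi (by decide) | exact E 0 H0 | exact E 2 H0
    · intro i hi
      replace hi := H0.symm.trans hi
      fin_cases i <;> first
        | exact absurd hi (by decide)
        | exact (R 0 rfl).trans L0
        | exact L2.trans (R 2 rfl)
    · rintro (_ | _)
      exacts [L0.symm, L2]
  · have H1 : s (.inr ()) = endSign 1 := h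
    have L0 := L 0 rfl
    have L2 := L 2 rfl
    refine circles_closeTwo_eq hs (fun b => O.boundary (if b then 2 else 1)) ?_ ?_ ?_
    · rintro (c | c) i hi
      · replace hi := hl.symm.trans hi
        fin_cases i <;> first | exact absurd hi (by decide) | rfl
      · replace hi := hr.symm.trans hi
        fin_cases i <;> first | exact absurd hi (by decide) | exact E 1 H1 | exact E 3 H1
    · intro i hi
      replace hi := H1.symm.trans hi
      fin_cases i <;> first
        | exact absurd hi (by decide)
        | exact (L0.symm.trans (R 1 rfl)).trans L2.symm
        | exact R 3 rfl
    · rintro (_ | _)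
      exacts [L0.symm, L2]
  · have H1 : s (.inr ()) = endSign 1 := h
    have R0 := R 0 rfl
    have R2 := R 2 rfl
    -- Now only the right crossing is horizontal, and the inner arcs continue to NE and SE.
    refine circles_closeTwo_eq hs (fun b => O.boundary (if b then 3 else 0)) ?_ ?_ ?_
    · rintro (c | c) i hi
      · replace hi := hl.symm.trans hi
        fin_cases i <;> first | exact absurd hi (by decide) | exact E 1 H1 | exact E 3 H1
      · replace hi := hr.symm.trans hi
        fin_cases i <;> first | exact absurd hi (by decide) | rfl
    · intro i hi
      replace hi := H1.symm.trans hi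
      fin_cases i <;> first
        | exact absurd hi (by decide)
        | exact L 1 rfl
        | exact (R2.symm.trans (L 3 rfl)).trans R0.symm
    · rintro (_ | _)
      exacts [R0, R2.symm]
  · simp at h'

end Circles

/-! ### Doubling a crossing: adequacy. -/

section Adequacy

variable {O} {k : Fin 4} {t : (O.closeTwo k).State} {s : (O.close k).State}

theorem circles_close (s : (O.close k).State) :
    (O.close k).circles s =
      (O.close 0).circles (Sum.elim (fun c => s (.inl c)) fun c => s (.inr c) * endSign k) :=
  (O.closeShadowIso k).circles_eq _ _ <| by
    rintro (c | c)
    · exact (mul_one _).symm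
    · simp [closeShadowIso, mul_assoc]

theorem circles_closeTwo (t : (O.closeTwo k).State) :
    (O.closeTwo k).circles t =
      (O.closeTwo 0).circles (Sum.elim (fun c => t (.inl c)) fun c => t (.inr c) * endSign k) :=
  (O.closeTwoShadowIso k).circles_eq _ _ <| by
    rintro (c | c)
    · exact (mul_one _).symm
    · simp [closeTwoShadowIso, mul_assoc]

theorem circles_closeTwo_of_eq_neg (hs : ∀ c, t (.inl c) = s (.inl c))
    (h : s (.inr ()) = -endSign k) (ht : ∀ c, t (.inr c) = -endSign k) :
    (O.closeTwo k).circles t = (O.close k).circles s + 1 := by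
  rw [circles_close, circles_closeTwo]
  exact circles_closeTwo_of_neg hs (by simp [h])
    (by simp [ht]) (by simp [ht])

theorem circles_closeTwo_of_eq (hs : ∀ c, t (.inl c) = s (.inl c))
    (h : s (.inr ()) * endSign k = t (.inr (.inl ())) * t (.inr (.inr ())))
    (h' : t (.inr (.inl ())) = endSign k ∨ t (.inr (.inr ())) = endSign k) :
    (O.closeTwo k).circles t = (O.close k).circles s := by
  rw [circles_close, circles_closeTwo]
  refine circles_closeTwo_of_one hs ?_ ?_
  · simp only [Sum.elim_inr]
    rw [h, mul_mul_mul_comm, endSign_mul_self, mul_one]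
  · simp only [Sum.elim_inr]
    exact h'.imp (fun h => by rw [h, endSign_mul_self]) fun h => by rw [h, endSign_mul_self]

theorem adequateAt_closeTwo {e : ℤˣ} (h : (O.close k).AdequateAt e) :
    (O.closeTwo k).AdequateAt e := by
  classical
  have hk := endSign_mul_self k
  -- For `e = endSign k` the two crossings are smoothed horizontally; otherwise they are smoothed
  -- vertically and cut off a small circle.
  by_cases he : e = endSign k
  · have h0 : (O.closeTwo k).circles (fun _ => e) = (O.close k).circles fun _ => e :=
      circles_closeTwo_of_eq (fun _ => rfl) (by rw [he]) (.inl he)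
    rw [PDCode.AdequateAt]
    rintro (c | c)
    · rw [h0, circles_closeTwo_of_eq (s := Function.update (fun _ => e) (.inl c) (-e))]
      · convert h (.inl c)
      · intro d
        by_cases hd : d = c <;> simp [hd]
      · simp [he]
      · simp [he]
    · rw [h0, circles_closeTwo_of_eq (s := Function.update (fun _ => e) (.inr ()) (-e))]
      · convert h (.inr ())
      · simp
      · rcases c with c | c <;> simp [he]
      · rcases c with c | c <;> simp [he]
  · replace he : e = -endSign k := Int.units_ne_iff_eq_neg.1 he
    have h0 : (O.closeTwo k).circles (fun _ => e) = (O.close k).circles (fun _ => e) + 1 :=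
      circles_closeTwo_of_eq_neg (fun _ => rfl) he fun _ => he
    rw [PDCode.AdequateAt]
    rintro (c | c)
    · rw [h0, circles_closeTwo_of_eq_neg (s := Function.update (fun _ => e) (.inl c) (-e))]
      · refine Nat.succ_lt_succ ?_
        convert h (.inl c)
      · intro d
        by_cases hd : d = c <;> simp [hd]
      · simp [he]
      · simp [he]
    -- Changing one of the two copies only removes the small circle; the comparison state of the
    -- single crossing is still constant, so `h` is not needed.
    · rw [h0, circles_closeTwo_of_eq (s := fun _ => e)]
      · exact Nat.lt_succ_self _
      · simp
      · rcases c with c | c <;> simp [he]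
      · rcases c with c | c <;> simp [he]

theorem isAdequateLinkDiagram_closeTwo (h : (O.close k).IsAdequateLinkDiagram) :
    (O.closeTwo k).IsAdequateLinkDiagram :=
  ⟨O.isLinkDiagram_closeTwo h.1, PDCode.adequate_iff.2 fun e =>
    adequateAt_closeTwo (PDCode.adequate_iff.1 h.2 e)⟩

end Adequacy

end Tangle

/-! ### Gluing, and moving a summand or factor to the outside. -/

namespace PDTangle

variable {ι Z : Type} {O T : PDTangle ι}

def glueInl (O T : PDTangle ι) (a : O.Arc) : (O.glue T).Arc := Quot.mk _ (.inl a)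

def glueInr (O T : PDTangle ι) (a : T.Arc) : (O.glue T).Arc := Quot.mk _ (.inr a)

theorem glueInl_boundary (i : ι) :
    glueInl O T (O.boundary i) = glueInr O T (T.boundary i) := Quot.sound ⟨i⟩

def glueLift (f : O.Arc → Z) (g : T.Arc → Z)
    (h : ∀ i, f (O.boundary i) = g (T.boundary i)) : (O.glue T).Arc → Z :=
  Quot.lift (Sum.elim f g) (by rintro _ _ ⟨i⟩; exact h i)

end PDTangle

namespace Tangle

open PDTangle

variable {O T U : Tangle} {Z : Type}

def sumInl (T U : Tangle) (a : T.Arc) : (T.sum U).Arc := Quot.mk _ (.inl a)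

def sumInr (T U : Tangle) (a : U.Arc) : (T.sum U).Arc := Quot.mk _ (.inr a)

theorem sum_north : sumInl T U (T.boundary 0) = sumInr T U (U.boundary 1) := Quot.sound .north

theorem sum_south : sumInl T U (T.boundary 3) = sumInr T U (U.boundary 2) := Quot.sound .south

def sumLift (f : T.Arc → Z) (g : U.Arc → Z) (h : f (T.boundary 0) = g (U.boundary 1))
    (h' : f (T.boundary 3) = g (U.boundary 2)) : (T.sum U).Arc → Z :=
  Quot.lift (Sum.elim f g) (by rintro _ _ (_ | _); exacts [h, h'])

def prodInl (T U : Tangle) (a : T.Arc) : (T.prod U).Arc := Quot.mk _ (.inl a)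

def prodInr (T U : Tangle) (a : U.Arc) : (T.prod U).Arc := Quot.mk _ (.inr a)

theorem prod_west : prodInl T U (T.boundary 2) = prodInr T U (U.boundary 1) := Quot.sound .west

theorem prod_east : prodInl T U (T.boundary 3) = prodInr T U (U.boundary 0) := Quot.sound .east

def prodLift (f : T.Arc → Z) (g : U.Arc → Z) (h : f (T.boundary 2) = g (U.boundary 1))
    (h' : f (T.boundary 3) = g (U.boundary 0)) : (T.prod U).Arc → Z :=
  Quot.lift (Sum.elim f g) (by rintro _ _ (_ | _); exacts [h, h'])

/-- The boundary points, reflected in a vertical axis. -/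
abbrev reflectEastWest (T : Tangle) : Tangle :=
  { T with boundary := ![T.boundary 1, T.boundary 0, T.boundary 3, T.boundary 2] }

/-- The boundary points, reflected in a horizontal axis. -/
abbrev reflectNorthSouth (T : Tangle) : Tangle :=
  { T with boundary := ![T.boundary 3, T.boundary 2, T.boundary 1, T.boundary 0] }

/-- The boundary points, rotated by a right angle. -/
abbrev rotate (T : Tangle) : Tangle :=
  { T with boundary := fun j => T.boundary (j + 1) }

def moveRight (α β γ : Type) : α ⊕ β ⊕ γ ≃ (α ⊕ γ) ⊕ β :=
  (Equiv.sumCongr (Equiv.refl α) (Equiv.sumComm β γ)).trans (Equiv.sumAssoc α γ β).symm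

def moveLeft (α β γ : Type) : α ⊕ β ⊕ γ ≃ (β ⊕ α) ⊕ γ :=
  (Equiv.sumAssoc α β γ).symm.trans (Equiv.sumCongr (Equiv.sumComm α β) (Equiv.refl γ))

/-- The right summand of a tangle may be counted as part of its outside. -/
def glueSumIsoRight (O T U : Tangle) : (O.glue (T.sum U)).Iso ((O.sum U.reflectEastWest).glue T) :=
  have ho (i : Fin 4) : glueInl O (T.sum U) (O.boundary i) = _ := glueInl_boundary i
  have ho' (i : Fin 4) : glueInl (O.sum U.reflectEastWest) T ((O.sum U.reflectEastWest).boundary i) = _ := glueInl_boundary i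
  have h1 := congrArg (glueInr O (T.sum U)) (sum_north (T := T) (U := U))
  have h2 := congrArg (glueInr O (T.sum U)) (sum_south (T := T) (U := U))
  have h1' := congrArg (glueInl (O.sum U.reflectEastWest) T) sum_north
  have h2' := congrArg (glueInl (O.sum U.reflectEastWest) T) sum_south
  -- The boundary points of an outside carry the labels of the disc that it surrounds. Here `U`
  -- meets `O` at its eastern points and `T` at its western ones, hence the exchanged labels; its
  -- crossings are not reflected.
  PDCode.Iso.ofEnds (moveRight O.Crossing T.Crossing U.Crossing)
    { toFun := glueLift (fun a => glueInl _ _ (sumInl O U.reflectEastWest a))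
        (sumLift (fun a => glueInr _ _ a) (fun a => glueInl _ _ (sumInr O U.reflectEastWest a))
          (ho' 0).symm (ho' 3).symm)
        (by
      intro i
      fin_cases i
      exacts [h1', ho' 1, ho' 2, h2'])
      invFun := glueLift (sumLift (fun a => glueInl _ _ a) (fun a => glueInr _ _ (sumInr T U a))
          (ho 0) (ho 3))
        (fun a => glueInr _ _ (sumInl T U a))
        (by
      intro i
      fin_cases i
      exacts [h1.symm, ho 1, ho 2, h2.symm])
      left_inv := by
        rintro ⟨a | ⟨⟨a⟩⟩⟩
        · rfl
        · rcases a with a | a <;> rfl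
      right_inv := by
        rintro ⟨⟨⟨a⟩⟩ | a⟩
        · rcases a with a | a <;> rfl
        · rfl }
    (by rintro (c | c | c) i <;> rfl)

/-- The left summand of a tangle may be counted as part of its outside. -/
def glueSumIsoLeft (O T U : Tangle) : (O.glue (T.sum U)).Iso ((T.reflectEastWest.sum O).glue U) :=
  have ho (i : Fin 4) : glueInl O (T.sum U) (O.boundary i) = _ := glueInl_boundary i
  have ho' (i : Fin 4) : glueInl (T.reflectEastWest.sum O) U ((T.reflectEastWest.sum O).boundary i) = _ := glueInl_boundary i
  have h1 := congrArg (glueInr O (T.sum U)) (sum_north (T := T) (U := U))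
  have h2 := congrArg (glueInr O (T.sum U)) (sum_south (T := T) (U := U))
  have h1' := congrArg (glueInl (T.reflectEastWest.sum O) U) sum_north
  have h2' := congrArg (glueInl (T.reflectEastWest.sum O) U) sum_south
  PDCode.Iso.ofEnds (moveLeft O.Crossing T.Crossing U.Crossing)
    { toFun := glueLift (fun a => glueInl _ _ (sumInr T.reflectEastWest O a))
        (sumLift (fun a => glueInl _ _ (sumInl T.reflectEastWest O a)) (fun a => glueInr _ _ a)
          (ho' 1) (ho' 2))
        (by
      intro i
      fin_cases i
      exacts [ho' 0, h1'.symm, h2'.symm, ho' 3])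
      invFun := glueLift (sumLift (fun a => glueInr _ _ (sumInl T U a)) (fun a => glueInl _ _ a)
          (ho 1).symm (ho 2).symm)
        (fun a => glueInr _ _ (sumInr T U a))
        (by
      intro i
      fin_cases i
      exacts [ho 0, h1, h2, ho 3])
      left_inv := by
        rintro ⟨a | ⟨⟨a⟩⟩⟩
        · rfl
        · rcases a with a | a <;> rfl
      right_inv := by
        rintro ⟨⟨⟨a⟩⟩ | a⟩
        · rcases a with a | a <;> rfl
        · rfl }
    (by rintro (c | c | c) i <;> rfl)

/-- The lower factor of a tangle may be counted as part of its outside. -/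
def glueProdIsoBottom (O T U : Tangle) : (O.glue (T.prod U)).Iso ((O.prod U.reflectNorthSouth).glue T) :=
  have ho (i : Fin 4) : glueInl O (T.prod U) (O.boundary i) = _ := glueInl_boundary i
  have ho' (i : Fin 4) : glueInl (O.prod U.reflectNorthSouth) T ((O.prod U.reflectNorthSouth).boundary i) = _ := glueInl_boundary i
  have h1 := congrArg (glueInr O (T.prod U)) (prod_west (T := T) (U := U))
  have h2 := congrArg (glueInr O (T.prod U)) (prod_east (T := T) (U := U))
  have h1' := congrArg (glueInl (O.prod U.reflectNorthSouth) T) prod_west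
  have h2' := congrArg (glueInl (O.prod U.reflectNorthSouth) T) prod_east
  PDCode.Iso.ofEnds (moveRight O.Crossing T.Crossing U.Crossing)
    { toFun := glueLift (fun a => glueInl _ _ (prodInl O U.reflectNorthSouth a))
        (prodLift (fun a => glueInr _ _ a) (fun a => glueInl _ _ (prodInr O U.reflectNorthSouth a))
          (ho' 2).symm (ho' 3).symm)
        (by
      intro i
      fin_cases i
      exacts [ho' 0, ho' 1, h1', h2'])
      invFun := glueLift (prodLift (fun a => glueInl _ _ a) (fun a => glueInr _ _ (prodInr T U a))
          (ho 2) (ho 3))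
        (fun a => glueInr _ _ (prodInl T U a))
        (by
      intro i
      fin_cases i
      exacts [ho 0, ho 1, h1.symm, h2.symm])
      left_inv := by
        rintro ⟨a | ⟨⟨a⟩⟩⟩
        · rfl
        · rcases a with a | a <;> rfl
      right_inv := by
        rintro ⟨⟨⟨a⟩⟩ | a⟩
        · rcases a with a | a <;> rfl
        · rfl }
    (by rintro (c | c | c) i <;> rfl)

/-- The upper factor of a tangle may be counted as part of its outside. -/
def glueProdIsoTop (O T U : Tangle) : (O.glue (T.prod U)).Iso ((T.reflectNorthSouth.prod O).glue U) :=
  have ho (i : Fin 4) : glueInl O (T.prod U) (O.boundary i) = _ := glueInl_boundary i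
  have ho' (i : Fin 4) : glueInl (T.reflectNorthSouth.prod O) U ((T.reflectNorthSouth.prod O).boundary i) = _ := glueInl_boundary i
  have h1 := congrArg (glueInr O (T.prod U)) (prod_west (T := T) (U := U))
  have h2 := congrArg (glueInr O (T.prod U)) (prod_east (T := T) (U := U))
  have h1' := congrArg (glueInl (T.reflectNorthSouth.prod O) U) prod_west
  have h2' := congrArg (glueInl (T.reflectNorthSouth.prod O) U) prod_east
  PDCode.Iso.ofEnds (moveLeft O.Crossing T.Crossing U.Crossing)
    { toFun := glueLift (fun a => glueInl _ _ (prodInr T.reflectNorthSouth O a))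
        (prodLift (fun a => glueInl _ _ (prodInl T.reflectNorthSouth O a)) (fun a => glueInr _ _ a)
          (ho' 1) (ho' 0))
        (by
      intro i
      fin_cases i
      exacts [h2'.symm, h1'.symm, ho' 2, ho' 3])
      invFun := glueLift (prodLift (fun a => glueInr _ _ (prodInl T U a)) (fun a => glueInl _ _ a)
          (ho 1).symm (ho 0).symm)
        (fun a => glueInr _ _ (prodInr T U a))
        (by
      intro i
      fin_cases i
      exacts [h2, h1, ho 2, ho 3])
      left_inv := by
        rintro ⟨a | ⟨⟨a⟩⟩⟩
        · rfl
        · rcases a with a | a <;> rfl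
      right_inv := by
        rintro ⟨⟨⟨a⟩⟩ | a⟩
        · rcases a with a | a <;> rfl
        · rfl }
    (by rintro (c | c | c) i <;> rfl)

/-- Rows, and rational tangles with a horizontal first box, start from `zero`; this removes it
again. -/
def glueZeroSumIso (O T : Tangle) : (O.glue T).Iso (O.glue (zero.sum T)) :=
  have ho (i : Fin 4) : glueInl O T (O.boundary i) = _ := glueInl_boundary i
  have ho' (i : Fin 4) : glueInl O (zero.sum T) (O.boundary i) = _ := glueInl_boundary i
  have h1 := congrArg (glueInr O (zero.sum T)) sum_north
  have h2 := congrArg (glueInr O (zero.sum T)) sum_south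
  PDCode.Iso.ofEnds (Equiv.sumCongr (Equiv.refl O.Crossing) (Equiv.emptySum Empty _).symm)
    { toFun := glueLift (glueInl _ _) (fun a => glueInr _ _ (sumInr zero T a)) (by
        intro i
        fin_cases i
        exacts [ho' 0, (ho' 1).trans h1, (ho' 2).trans h2, ho' 3])
      invFun := glueLift (glueInl _ _) (sumLift (T := zero)
        ![glueInr _ _ (T.boundary 1), glueInr _ _ (T.boundary 2)] (glueInr _ _) rfl rfl) (by
        intro i
        fin_cases i
        exacts [ho 0, ho 1, ho 2, ho 3])
      left_inv := by rintro ⟨a | a⟩ <;> rfl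
      right_inv := by
        rintro ⟨a | ⟨⟨a⟩⟩⟩
        · rfl
        rcases a with a | a
        · change Fin 2 at a
          fin_cases a
          exacts [h1.symm, h2.symm]
        · rfl }
    (by rintro (c | c) i <;> rfl)

def glueInfinityProdIso (O T : Tangle) : (O.glue T).Iso (O.glue (infinity.prod T)) :=
  have ho (i : Fin 4) : glueInl O T (O.boundary i) = _ := glueInl_boundary i
  have ho' (i : Fin 4) : glueInl O (infinity.prod T) (O.boundary i) = _ := glueInl_boundary i
  have h1 := congrArg (glueInr O (infinity.prod T)) prod_west
  have h2 := congrArg (glueInr O (infinity.prod T)) prod_east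
  PDCode.Iso.ofEnds (Equiv.sumCongr (Equiv.refl O.Crossing) (Equiv.emptySum Empty _).symm)
    { toFun := glueLift (glueInl _ _) (fun a => glueInr _ _ (prodInr infinity T a)) (by
        intro i
        fin_cases i
        exacts [(ho' 0).trans h2, (ho' 1).trans h1, ho' 2, ho' 3])
      invFun := glueLift (glueInl _ _) (prodLift (T := infinity)
        ![glueInr _ _ (T.boundary 0), glueInr _ _ (T.boundary 1)] (glueInr _ _) rfl rfl) (by
        intro i
        fin_cases i
        exacts [ho 0, ho 1, ho 2, ho 3])
      left_inv := by rintro ⟨a | a⟩ <;> rfl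
      right_inv := by
        rintro ⟨a | ⟨⟨a⟩⟩⟩
        · rfl
        rcases a with a | a
        · change Fin 2 at a
          fin_cases a
          exacts [h2.symm, h1.symm]
        · rfl }
    (by rintro (c | c) i <;> rfl)

/-! ### Filling the disc with one or two crossings. -/

/-- The end of a crossing of sign `e` that is drawn at NE. -/
def northEastEnd (e : ℤˣ) : Fin 4 := if e = 1 then 1 else 0

theorem crossing_boundary (e : ℤˣ) (j : Fin 4) :
    (crossing e).boundary j = j + northEastEnd e := by
  simp only [crossing, northEastEnd]
  split_ifs
  · rfl
  · exact (add_zero j).symm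

def glueCrossingIso (O : Tangle) (e : ℤˣ) :
    (O.glue (crossing e)).Iso (O.close (northEastEnd e)) :=
  PDCode.Iso.ofEnds (Equiv.refl _)
    { toFun := glueLift id (fun i : Fin 4 => O.boundary (i - northEastEnd e)) fun i => by
        rw [crossing_boundary]
        simp
      invFun := glueInl _ _
      left_inv := by
        rintro ⟨a | i⟩
        · rfl
        · refine (glueInl_boundary _).trans (congrArg _ ?_)
          rw [crossing_boundary]
          exact sub_add_cancel (G := Fin 4) _ _
      right_inv _ := rfl }
    (by rintro (c | c) i <;> rfl)

/-- A row of two crossings. -/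
def glueCrossingSumIso (O : Tangle) (e : ℤˣ) :
    (O.glue ((crossing e).sum (crossing e))).Iso (O.closeTwo (northEastEnd e)) :=
  let C := crossing e
  let L : Fin 4 → O.Arc ⊕ Bool := (O.closeTwo (northEastEnd e)).ends (.inr (.inl ()))
  let R : Fin 4 → O.Arc ⊕ Bool := (O.closeTwo (northEastEnd e)).ends (.inr (.inr ()))
  have ho (i : Fin 4) : glueInl O (C.sum C) (O.boundary i) = _ := glueInl_boundary i
  have h1 := congrArg (glueInr O (C.sum C)) sum_north
  have h2 := congrArg (glueInr O (C.sum C)) sum_south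
  PDCode.Iso.ofEnds (Equiv.refl _)
    { toFun := glueLift .inl
        (sumLift L R
          (by rcases Int.units_eq_one_or e with rfl | rfl <;> rfl)
          (by rcases Int.units_eq_one_or e with rfl | rfl <;> rfl))
        (by
          intro i
          rcases Int.units_eq_one_or e with rfl | rfl <;> fin_cases i <;> rfl)
      invFun := Sum.elim (glueInl O _) fun b =>
        glueInr _ _ (sumInl C C (C.boundary (if b then 3 else 0)))
      left_inv := by
        rintro ⟨a | ⟨⟨i⟩⟩⟩
        · rfl
        rcases i with i | i <;> change Fin 4 at i <;>
          rcases Int.units_eq_one_or e with rfl | rfl <;> fin_cases i <;> first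
            | rfl
            | exact h1
            | exact h2
            | exact ho 0
            | exact ho 1
            | exact ho 2
            | exact ho 3
      right_inv := by
        rintro (a | _ | _)
        · rfl
        all_goals rcases Int.units_eq_one_or e with rfl | rfl <;> rfl }
    (by rintro (c | c | c) i <;> rfl)

/-- A stack of two crossings. -/
def glueCrossingProdIso (O : Tangle) (e : ℤˣ) :
    (O.glue ((crossing e).prod (crossing e))).Iso (O.rotate.closeTwo (northEastEnd e + 1)) :=
  let C := crossing e
  let L : Fin 4 → O.Arc ⊕ Bool := (O.rotate.closeTwo (northEastEnd e + 1)).ends (.inr (.inl ()))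
  let R : Fin 4 → O.Arc ⊕ Bool := (O.rotate.closeTwo (northEastEnd e + 1)).ends (.inr (.inr ()))
  have ho (i : Fin 4) : glueInl O (C.prod C) (O.boundary i) = _ := glueInl_boundary i
  have h1 := congrArg (glueInr O (C.prod C)) prod_west
  have h2 := congrArg (glueInr O (C.prod C)) prod_east
  -- After the rotation NW lies at NE, so the upper crossing becomes the right one.
  PDCode.Iso.ofEnds (Equiv.sumCongr (Equiv.refl _) (Equiv.sumComm _ _))
    { toFun := glueLift .inl
        (prodLift R L
          (by rcases Int.units_eq_one_or e with rfl | rfl <;> rfl)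
          (by rcases Int.units_eq_one_or e with rfl | rfl <;> rfl))
        (by
          intro i
          rcases Int.units_eq_one_or e with rfl | rfl <;> fin_cases i <;> rfl)
      invFun := Sum.elim (glueInl O _) fun b =>
        glueInr _ _ (prodInl C C (C.boundary (if b then 3 else 2)))
      left_inv := by
        rintro ⟨a | ⟨⟨i⟩⟩⟩
        · rfl
        rcases i with i | i <;> change Fin 4 at i <;>
          rcases Int.units_eq_one_or e with rfl | rfl <;> fin_cases i <;> first
            | rfl
            | exact h1
            | exact h2
            | exact ho 0
            | exact ho 1
            | exact ho 2
            | exact ho 3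
      right_inv := by
        rintro (a | _ | _)
        · rfl
        all_goals rcases Int.units_eq_one_or e with rfl | rfl <;> rfl }
    (by rintro (c | c | c) i <;> rfl)

/-- The crossing that closes a tangle, seen after a rotation by a right angle. -/
def closeRotateIso (O : Tangle) (k : Fin 4) : (O.close k).Iso (O.rotate.close (k + 1)) :=
  PDCode.Iso.ofEnds (Equiv.refl _) (Equiv.refl _) (by
    rintro (c | c) i
    · rfl
    · exact congrArg O.boundary (by revert i k; decide))

/-! ### Tangles that may replace a crossing. -/

/-- If a crossing of sign `e` in an adequate link diagram is replaced by `T`, then the result is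
an adequate link diagram. -/
def PreservesAdequacy (e : ℤˣ) (T : Tangle) : Prop :=
  ∀ O : Tangle, (O.glue (crossing e)).IsAdequateLinkDiagram → (O.glue T).IsAdequateLinkDiagram

variable {e : ℤˣ}

theorem preservesAdequacy_crossing : PreservesAdequacy e (crossing e) := fun _ h => h

/-- The crossing grows in three stages: to two crossings, to `T` beside a crossing, and to `T`
beside `U`. Each of the last two replaces a crossing whose outside contains the other summand. -/
theorem PreservesAdequacy.sum (hT : PreservesAdequacy e T) (hU : PreservesAdequacy e U) :
    PreservesAdequacy e (T.sum U) := fun O h => by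
  have h2 := (glueCrossingSumIso O e).symm.isAdequateLinkDiagram
    (isAdequateLinkDiagram_closeTwo ((glueCrossingIso O e).isAdequateLinkDiagram h))
  have hTc := (glueSumIsoRight O T (crossing e)).symm.isAdequateLinkDiagram
    (hT _ ((glueSumIsoRight O _ _).isAdequateLinkDiagram h2))
  exact (glueSumIsoLeft O T U).symm.isAdequateLinkDiagram
    (hU _ ((glueSumIsoLeft O _ _).isAdequateLinkDiagram hTc))

/-- A right angle turns the stack into a row. It also turns the sign of the crossing, which is
harmless because doubling is available for every `k`. -/
theorem PreservesAdequacy.prod (hT : PreservesAdequacy e T) (hU : PreservesAdequacy e U) :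
    PreservesAdequacy e (T.prod U) := fun O h => by
  have h1 := (closeRotateIso O _).isAdequateLinkDiagram
    ((glueCrossingIso O e).isAdequateLinkDiagram h)
  have h2 := (glueCrossingProdIso O e).symm.isAdequateLinkDiagram
    (isAdequateLinkDiagram_closeTwo h1)
  have hTc := (glueProdIsoBottom O T (crossing e)).symm.isAdequateLinkDiagram
    (hT _ ((glueProdIsoBottom O _ _).isAdequateLinkDiagram h2))
  exact (glueProdIsoTop O T U).symm.isAdequateLinkDiagram
    (hU _ ((glueProdIsoTop O _ _).isAdequateLinkDiagram hTc))

theorem PreservesAdequacy.zero_sum (hT : PreservesAdequacy e T) :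
    PreservesAdequacy e (zero.sum T) := fun O h =>
  (glueZeroSumIso O T).isAdequateLinkDiagram (hT O h)

theorem PreservesAdequacy.infinity_prod (hT : PreservesAdequacy e T) :
    PreservesAdequacy e (infinity.prod T) := fun O h =>
  (glueInfinityProdIso O T).isAdequateLinkDiagram (hT O h)

theorem preservesAdequacy_row {n : ℕ} (hn : n ≠ 0) : PreservesAdequacy e (row e n) := by
  induction n with
  | zero => exact absurd rfl hn
  | succ n ih =>
    rcases eq_or_ne n 0 with rfl | h
    -- The induction really starts at one crossing, since the empty row is not a replacement covered
    -- by the doubling argument.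
    · exact preservesAdequacy_crossing.zero_sum
    · exact (ih h).sum preservesAdequacy_crossing

theorem preservesAdequacy_stack {n : ℕ} (hn : n ≠ 0) : PreservesAdequacy e (stack e n) := by
  induction n with
  | zero => exact absurd rfl hn
  | succ n ih =>
    rcases eq_or_ne n 0 with rfl | h
    · exact preservesAdequacy_crossing.infinity_prod
    · exact (ih h).prod preservesAdequacy_crossing

theorem boxSign_eq {a : ℤ} (h : a.sign = (e : ℤ)) : boxSign a = e ∧ a.natAbs ≠ 0 := by
  rcases Int.units_eq_one_or e with rfl | rfl
  · have := Int.sign_eq_one_iff_pos.1 h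
    exact ⟨if_pos this.le, Int.natAbs_ne_zero.2 this.ne'⟩
  · have := Int.sign_eq_neg_one_iff_neg.1 h
    exact ⟨if_neg this.not_ge, Int.natAbs_ne_zero.2 this.ne⟩

theorem PreservesAdequacy.addBoxes (l : List ℤ) (hl : ∀ x ∈ l, x.sign = (e : ℤ)) (x : Axis)
    (hT : PreservesAdequacy e T) : PreservesAdequacy e (T.addBoxes x l) := by
  induction l generalizing T x with
  | nil => cases x <;> exact hT
  | cons a l ih =>
    have hl' : ∀ x ∈ l, x.sign = (e : ℤ) := fun x hx => hl x (List.mem_cons_of_mem a hx)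
    obtain ⟨rfl, ha⟩ := boxSign_eq (hl a List.mem_cons_self)
    cases x
    · exact ih hl' _ (hT.sum (preservesAdequacy_row ha))
    · exact ih hl' _ (hT.prod (preservesAdequacy_stack ha))

theorem preservesAdequacy_rational {l : List ℤ} (h : l ≠ []) (hl : ∀ x ∈ l, x.sign = (e : ℤ))
    (x : Axis) : PreservesAdequacy e (rational x l) := by
  obtain ⟨a, l, rfl⟩ := List.exists_cons_of_ne_nil h
  have hl' : ∀ x ∈ l, x.sign = (e : ℤ) := fun x hx => hl x (List.mem_cons_of_mem a hx)
  obtain ⟨rfl, ha⟩ := boxSign_eq (hl a List.mem_cons_self)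
  cases x
  · exact (preservesAdequacy_row ha).zero_sum.addBoxes l hl' _
  · exact (preservesAdequacy_stack ha).infinity_prod.addBoxes l hl' _

end Tangle

theorem Block.Extends.preservesAdequacy {e : ℤˣ} {b : Block} (h : b.Extends e) :
    Tangle.PreservesAdequacy e b.tangle := by
  induction b with
  | rational x a => exact Tangle.preservesAdequacy_rational h.1 h.2 x
  | sum b b' ih ih' => exact (ih h.1).sum (ih' h.2)
  | prod b b' ih ih' => exact (ih h.1).prod (ih' h.2)

/-! ### Putting a crossing back into its outside. -/

namespace PDCode

open Classical in
/-- A diagram is obtained from the outside of a crossing by putting the crossing back. -/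
noncomputable def closeOutsideIso (D : PDCode) (c : D.Crossing) (k : Fin 4) :
    ((D.outside c k).close (Tangle.northEastEnd (D.sign c k))).Iso D where
  crossing := (Equiv.sumComm _ _).trans (Equiv.trans
    (Equiv.sumCongr (Equiv.equivPUnit {d // d = c}).symm (Equiv.refl _)) (Equiv.sumCompl (· = c)))
  arc := Equiv.refl _
  -- The sign only records the parity of `k`, so the standard crossing agrees with `c` up to a half
  -- turn, which `Iso` allows.
  rot := Sum.elim (fun _ => 0) fun _ => k - Tangle.northEastEnd (D.sign c k)
  rot_eq := by
    rintro (d | d)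
    · exact .inl rfl
    · fin_cases k <;> simp [sign, Tangle.northEastEnd]
  ends_eq := by
    rintro (d | d) i
    · exact congrArg (D.ends d.1) (add_zero i)
    · exact congrArg (D.ends c) (by simp only [Sum.elim_inr]; abel)

end PDCode

end PlanarLink

theorem theorem3p3 (D : PlanarLink.LinkDiagram) (hD : D.1.Adequate)
    (c : D.1.Crossing) (k : Fin 4) (b : PlanarLink.Block)
    (hb : b.Extends (D.1.sign c k)) :
    ∃ h : (D.1.replace c k b.tangle).IsLinkDiagram,
      (D.1.replace c k b.tangle).Adequate ∧
      (PlanarLink.LinkDiagram.link ⟨D.1.replace c k b.tangle, h⟩).Adequate := by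
  have h := hb.preservesAdequacy (D.1.outside c k)
    ((PlanarLink.Tangle.glueCrossingIso _ _).symm.isAdequateLinkDiagram
      ((D.1.closeOutsideIso c k).symm.isAdequateLinkDiagram ⟨D.2, hD⟩))
  exact ⟨h.1, h.2, ⟨_, h.1⟩, rfl, h.2⟩
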